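/- Let $\mathcal G$ be a directed acyclic graph on the vertices $1,\dots,d$, and write $\mathrm{pa}(i,\mathcal G)$ for the set of parents of $i$ in $\mathcal G$. Let $X=(X_1,\dots,X_d)$ be real random variables satisfying the additive noise model $$X_i=f_i\big(X_{\mathrm{pa}(i,\mathcal G)}\big)+\epsilon_i,\qquad i=1,\dots,d,$$ where the functions $f_i$ are continuous and the noise variables $\epsilon_1,\dots,\epsilon_d$ are jointly independent, each having a strictly positive density with respect to Lebesgue measure. Let $P$ be the distribution of $X$, and assume causal minimality: $P$ does not satisfy the (directed local) Markov property with respect to any graph obtained from $\mathcal G$ by deleting at least one edge. Let $\mathcal H$ be a directed acyclic super-graph of $\mathcal G$ on the same vertices, i.e. every edge of $\mathcal G$ is an edge of $\mathcal H$. Then, for every $i$, the set $\mathrm{pa}(i,\mathcal G)$ is the unique subset $T$ of $\mathrm{pa}(i,\mathcal H)$ such that 1. $X_i$ is conditionally independent of the vector $X_{\mathrm{pa}(i,\mathcal H)\setminus T}$ of all remaining $\mathcal H$-parents given $X_T$; and 2. $T$ is minimal with this property: no strict subset $T'\subsetneq T$ is such that $X_i$ is conditionally independent of $X_{\mathrm{pa}(i,\mathcal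 H)\setminus T'}$ given $X_{T'}$. (Faithfulness of $P$ to $\mathcal G$ is not assumed.) -/

import Mathlib

open MeasureTheory ProbabilityTheory

namespace CausalDAG

/-- A directed graph is acyclic if no vertex can be reached from itself by a directed path of
positive length. An edge from `j` to `i` is `G.Adj j i`. -/
def IsDAG {d : ℕ} (G : Digraph (Fin d)) : Prop :=
  ∀ i, ¬ Relation.TransGen G.Adj i i

/-- The set of parents of the vertex `i`. -/
def parents {d : ℕ} (G : Digraph (Fin d)) (i : Fin d) : Set (Fin d) :=
  {j | G.Adj j i}

/-- The non-descendants of `i` other than `i` itself: the vertices that cannot be reached from `i`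
by a (possibly trivial) directed path. -/
def nonDescendants {d : ℕ} (G : Digraph (Fin d)) (i : Fin d) : Set (Fin d) :=
  {j | ¬ Relation.ReflTransGen G.Adj i j}

/-- An additive noise model on the directed graph `G`: the functions `f i` of the values of the
parents of `i`, and the densities of the noise variables with respect to Lebesgue measure. -/
structure AdditiveNoiseModel {d : ℕ} (G : Digraph (Fin d)) where
  /-- the deterministic function in the `i`-th structural equation -/
  f : ∀ i : Fin d, (parents G i → ℝ) → ℝ
  continuous_f : ∀ i, Continuous (f i)
  /-- the density of the `i`-th noise variable -/
  noiseDensity : Fin d → ℝ → ℝ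
  measurable_noiseDensity : ∀ i, Measurable (noiseDensity i)
  noiseDensity_pos : ∀ i t, 0 < noiseDensity i t

/-- The random variables `X i` satisfy the structural equations `X i = f i (X_pa(i)) + ε i` of the
model `M`, where the noise variables `ε i` are jointly independent with the prescribed densities. -/
structure AdditiveNoiseModel.IsSolution {d : ℕ} {G : Digraph (Fin d)} (M : AdditiveNoiseModel G)
    {Ω : Type*} [MeasurableSpace Ω] (μ : Measure Ω) (X ε : Fin d → Ω → ℝ) : Prop where
  measurable_var : ∀ i, Measurable (X i)
  measurable_noise : ∀ i, Measurable (ε i)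
  indep_noise : iIndepFun ε μ
  map_noise : ∀ i,
    μ.map (ε i) = volume.withDensity (fun t => ENNReal.ofReal (M.noiseDensity i t))
  structural_eq : ∀ i, ∀ᵐ ω ∂μ, X i ω = M.f i (fun j => X j ω) + ε i ω

/-- The joint distribution of the random vector `(X 0, …, X (d - 1))`. -/
noncomputable abbrev jointLaw {d : ℕ} {Ω : Type*} [MeasurableSpace Ω] (μ : Measure Ω)
    (X : Fin d → Ω → ℝ) : Measure (Fin d → ℝ) :=
  μ.map (fun ω i => X i ω)

/-- Under the distribution `P` on `ℝ^d`, the coordinate vectors `x_A` and `x_B` are conditionally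
independent given the σ-algebra generated by the coordinate vector `x_C`. -/
def CondIndepCoord {d : ℕ} (P : Measure (Fin d → ℝ)) [IsFiniteMeasure P]
    (A B C : Set (Fin d)) : Prop :=
  CondIndepFun (MeasurableSpace.comap (fun (x : Fin d → ℝ) (k : C) => x k) inferInstance)
    (Measurable.comap_le (measurable_pi_lambda _ fun k => measurable_pi_apply (k : Fin d)))
    (fun (x : Fin d → ℝ) (k : A) => x k) (fun (x : Fin d → ℝ) (k : B) => x k) P

/-- The directed local Markov property: given its parents, every variable is independent of its
other non-descendants. -/
def IsMarkov {d : ℕ} (P : Measure (Fin d → ℝ)) [IsFiniteMeasure P] (G : Digraph (Fin d)) : Prop :=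
  ∀ i, CondIndepCoord P {i} (nonDescendants G i \ parents G i) (parents G i)

/-- Causal minimality of `P` with respect to `G`: `P` is not Markov with respect to any graph
obtained from `G` by removing at least one edge. That `P` is Markov with respect to `G` itself is
not required here, as it is automatic for a distribution induced by a structural equation model
on `G`. -/
def CausallyMinimal {d : ℕ} (P : Measure (Fin d → ℝ)) [IsFiniteMeasure P]
    (G : Digraph (Fin d)) : Prop :=
  ∀ G' : Digraph (Fin d), G' < G → ¬ IsMarkov P G'

/-- Given `X_T`, the variable `X_i` is independent of the vector of all its remaining
`H`-parents. -/
def ScreensOff {d : ℕ} (P : Measure (Fin d → ℝ)) [IsFiniteMeasure P] (H : Digraph (Fin d))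
    (i : Fin d) (T : Set (Fin d)) : Prop :=
  CondIndepCoord P {i} (parents H i \ T) T

/-- `T` is a set of `H`-parents of `i` given which `X_i` is independent of the remaining
`H`-parents, and no strict subset of `T` has this property. -/
structure IsMinimalScreen {d : ℕ} (P : Measure (Fin d → ℝ)) [IsFiniteMeasure P]
    (H : Digraph (Fin d)) (i : Fin d) (T : Set (Fin d)) : Prop where
  subset_parents : T ⊆ parents H i
  screensOff : ScreensOff P H i T
  minimal : ∀ T', T' ⊂ T → ¬ ScreensOff P H i T'

end CausalDAG

/-! The noise of vertex `i` is the residual `x i - F i x`. Solving the structural equations along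
the acyclic order makes every non-descendant of `i` a function of the residuals at non-descendants,
so the residual at `i` is independent of all of them, in particular of the `H`-parents. Hence
`parents G i` screens off (`condIndepCoord_parents`).

It is also the least screening set. If `T` screens off, the conditional law of `X i` given all
`H`-parents, which is the noise law shifted by `F i`, depends on `X_T` alone. The noise has a
strictly increasing distribution function, so `F i` is almost everywhere a function of `X_T`. The
joint law dominates Lebesgue measure and `F i` is continuous, so `F i` depends only on `T`
everywhere (`dependsOn_of_condIndepCoord`). The edges into `i` from outside `T` are then
superfluous, and causal minimality forbids them (`parents_subset_of_dependsOn`). -/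

namespace CausalDAG

/-! ### Lebesgue measure and dependence on coordinates -/

theorem volume_absolutelyContinuous_pi {n : ℕ} (N : Fin n → Measure ℝ) [∀ i, SigmaFinite (N i)]
    (hN : ∀ i, (volume : Measure ℝ) ≪ N i) :
    (volume : Measure (Fin n → ℝ)) ≪ Measure.pi N := by
  induction n with
  | zero =>
    rw [volume_pi]
    exact (congrArg Measure.pi (Subsingleton.elim _ _)).absolutelyContinuous
  | succ n ih =>
    have h₁ := (volume_preserving_piFinSuccAbove (fun _ : Fin (n + 1) => ℝ) 0).symm
    have h₂ := (measurePreserving_piFinSuccAbove N 0).symm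
    rw [← h₁.map_eq, ← h₂.map_eq]
    refine Measure.AbsolutelyContinuous.map ?_ (MeasurableEquiv.measurable _)
    exact (hN 0).prod (ih (fun j => N (Fin.succAbove 0 j)) fun j => hN _)

/-- Subtracting from one coordinate a function of the other coordinates preserves volume. -/
theorem measurePreserving_update_sub {ι : Type*} [Fintype ι] [DecidableEq ι] (a : ι)
    {F : (ι → ℝ) → ℝ} (hF : Measurable F) (hdep : DependsOn F {a}ᶜ) :
    MeasurePreserving (fun x : ι → ℝ => Function.update x a (x a - F x)) volume volume := by
  let e := MeasurableEquiv.piEquivPiSubtypeProd (fun _ : ι => ℝ) (fun j => j ≠ a)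
  have he : MeasurePreserving e volume volume :=
    volume_preserving_piEquivPiSubtypeProd (fun _ : ι => ℝ) (fun j => j ≠ a)
  -- With the other coordinates fixed, the map is a translation of coordinate `a`.
  have hskew : MeasurePreserving
      (fun p : ({j // j ≠ a} → ℝ) × ({j // ¬ j ≠ a} → ℝ) =>
        (p.1, p.2 - fun _ => F (e.symm (p.1, 0)))) (volume.prod volume) (volume.prod volume) := by
    refine MeasurePreserving.skew_product (g := fun u c => c - fun _ => F (e.symm (u, 0)))
      (MeasurePreserving.id volume) ?_ (ae_of_all _ fun u => ?_)
    · unfold Function.uncurry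
      fun_prop
    · exact (measurePreserving_sub_right volume _).map_eq
  convert he.symm.comp (hskew.comp he) using 1
  ext x j
  have hFx : F (e.symm ((e x).1, 0)) = F x := by
    refine hdep fun k hk => ?_
    have hk' : k ≠ a := hk
    simp [e, MeasurableEquiv.piEquivPiSubtypeProd, Equiv.piEquivPiSubtypeProd, hk']
  simp only [Function.comp_apply, hFx]
  by_cases hj : j = a
  · subst hj
    simp [e, MeasurableEquiv.piEquivPiSubtypeProd, Equiv.piEquivPiSubtypeProd]
  · simp [e, MeasurableEquiv.piEquivPiSubtypeProd, Equiv.piEquivPiSubtypeProd, hj]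

/-- Replacing independently the coordinates outside of `T` is nonsingular for the volume. -/
theorem quasiMeasurePreserving_piecewise {ι : Type*} [Fintype ι] (T : Set ι)
    [DecidablePred (· ∈ T)] :
    Measure.QuasiMeasurePreserving (fun p : (ι → ℝ) × (ι → ℝ) => T.piecewise p.1 p.2)
      (volume.prod volume) volume := by
  let e := MeasurableEquiv.piEquivPiSubtypeProd (fun _ : ι => ℝ) (· ∈ T)
  have he : MeasurePreserving e volume volume :=
    volume_preserving_piEquivPiSubtypeProd (fun _ : ι => ℝ) (· ∈ T)
  have h₁ : Measure.QuasiMeasurePreserving (fun x => (e x).1) volume volume :=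
    Measure.quasiMeasurePreserving_fst.comp he.quasiMeasurePreserving
  have h₂ : Measure.QuasiMeasurePreserving (fun x => (e x).2) volume volume :=
    Measure.quasiMeasurePreserving_snd.comp he.quasiMeasurePreserving
  have h₃ : Measure.QuasiMeasurePreserving (Prod.map (fun x => (e x).1) (fun x => (e x).2))
      (volume.prod volume) (volume.prod volume) := by
    refine ⟨by fun_prop, ?_⟩
    rw [← Measure.map_prod_map _ _ (by fun_prop) (by fun_prop)]
    exact h₁.absolutelyContinuous.prod h₂.absolutelyContinuous
  convert he.symm.quasiMeasurePreserving.comp h₃ using 1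
  ext p j
  by_cases hj : j ∈ T <;>
  simp [e, MeasurableEquiv.piEquivPiSubtypeProd, Equiv.piEquivPiSubtypeProd, hj]

/-- A continuous function that is almost everywhere determined by the coordinates in `T` depends
only on these coordinates. -/
theorem dependsOn_of_ae {ι β : Type*} [Fintype ι] {F : (ι → ℝ) → ℝ} (hF : Continuous F)
    (T : Set ι) (φ : ℝ → β) (hφ : Function.Injective φ) (h : (T → ℝ) → β)
    (hae : ∀ᵐ x : ι → ℝ, φ (F x) = h (fun k => x k)) : DependsOn F T := by
  classical
  have h₁ : ∀ᵐ p : (ι → ℝ) × (ι → ℝ) ∂(volume.prod volume), φ (F p.1) = h (fun k => p.1 k) :=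
    Measure.quasiMeasurePreserving_fst.ae hae
  have h₂ := (quasiMeasurePreserving_piecewise T).ae hae
  have hpc : Continuous fun p : (ι → ℝ) × (ι → ℝ) => T.piecewise p.1 p.2 := by
    refine continuous_pi fun j => ?_
    by_cases hj : j ∈ T <;> simp only [Set.piecewise, hj, if_true, if_false] <;> fun_prop
  -- Lebesgue measure charges open sets, so continuous functions equal almost everywhere are equal.
  have h₃ : (fun p : (ι → ℝ) × (ι → ℝ) => F p.1) = fun p => F (T.piecewise p.1 p.2) := by
    refine (Continuous.ae_eq_iff_eq (volume.prod volume) (by fun_prop) (hF.comp hpc)).1 ?_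
    filter_upwards [h₁, h₂] with p hp₁ hp₂
    refine hφ (hp₁.trans (Eq.trans ?_ hp₂.symm))
    congr 1
    ext k
    simp
  intro x y hxy
  have := congrFun h₃ (x, y)
  simp only at this
  rw [this]
  congr 1
  ext j
  by_cases hj : j ∈ T
  · simp [hj, hxy j hj]
  · simp [hj]

/-- The hybrid point equal to `x` on `s` and to `y` off `s` agrees with `x` on `s` and with `y` on
`t`. -/
theorem _root_.DependsOn.inter {ι : Type*} {α : ι → Type*} {β : Type*} {f : (∀ i, α i) → β}
    {s t : Set ι} (hs : DependsOn f s) (ht : DependsOn f t) : DependsOn f (s ∩ t) := by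
  classical
  intro x y hxy
  have h₁ : f x = f (s.piecewise x y) := hs fun i hi => by simp [hi]
  refine h₁.trans (ht fun i hi => ?_)
  by_cases his : i ∈ s
  · simp [his, hxy i ⟨his, hi⟩]
  · simp [his]

/-- Every interval `(a, b]` with `a < b` has positive mass. -/
theorem measure_Iic_neg_injective (N : Measure ℝ) [IsFiniteMeasure N]
    (hN : (volume : Measure ℝ) ≪ N) : Function.Injective fun a : ℝ => N (Set.Iic (-a)) := by
  have key : ∀ a b : ℝ, a < b → N (Set.Iic a) ≠ N (Set.Iic b) := by
    intro a b hab h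
    have h₀ : N (Set.Ioc a b) = 0 := by
      rw [← Set.Iic_sdiff_Iic, measure_sdiff (Set.Iic_subset_Iic.2 hab.le)
        measurableSet_Iic.nullMeasurableSet (measure_ne_top _ _), h, tsub_self]
    have := hN h₀
    simp [hab.not_ge] at this
  intro a b h
  by_contra hne
  rcases lt_or_gt_of_ne hne with hlt | hlt
  · exact key _ _ (neg_lt_neg hlt) h.symm
  · exact key _ _ (neg_lt_neg hlt) h

end CausalDAG

/-! ### Residuals of the structural equations -/

namespace CausalDAG

variable {d : ℕ} {G : Digraph (Fin d)}

theorem IsDAG.wellFounded (hG : IsDAG G) : WellFounded G.Adj := by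
  have : Std.Irrefl (Relation.TransGen G.Adj) := ⟨hG⟩
  exact Subrelation.wf (Relation.TransGen.single)
    (Finite.wellFounded_of_trans_of_irrefl (Relation.TransGen G.Adj))

theorem IsDAG.mono {G H : Digraph (Fin d)} (hH : IsDAG H) (h : G ≤ H) : IsDAG G :=
  fun i hi => hH i (Relation.TransGen.mono (fun _ _ hab => h hab) _ _ hi)

/-- The residuals of the structural equations with functions `F`. -/
def structuralResidual (F : Fin d → (Fin d → ℝ) → ℝ) (i : Fin d) (x : Fin d → ℝ) : ℝ := x i - F i x

theorem measurable_residual {F : Fin d → (Fin d → ℝ) → ℝ} (hF : ∀ i, Continuous (F i))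
    (i : Fin d) : Measurable (structuralResidual F i) :=
  (measurable_pi_apply i).sub (hF i).measurable

theorem residual_injective (hG : IsDAG G) {F : Fin d → (Fin d → ℝ) → ℝ}
    (hdep : ∀ i, DependsOn (F i) (parents G i)) :
    Function.Injective fun (x : Fin d → ℝ) i => structuralResidual F i x := by
  intro x y hxy
  ext i
  induction i using hG.wellFounded.induction with
  | _ i ih =>
    have h₁ : x i - F i x = y i - F i y := congrFun hxy i
    have h₂ : F i x = F i y := hdep i fun j hj => ih j hj
    linarith

/-- The residual map is a composition of volume-preserving shears, one per vertex, with children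
treated before their parents. -/
theorem measurePreserving_residual (hG : IsDAG G) {F : Fin d → (Fin d → ℝ) → ℝ}
    (hF : ∀ i, Continuous (F i)) (hdep : ∀ i, DependsOn (F i) (parents G i)) :
    MeasurePreserving (fun (x : Fin d → ℝ) i => structuralResidual F i x) volume volume := by
  have key : ∀ A : Finset (Fin d), (∀ j ∈ A, ∀ i, G.Adj j i → i ∈ A) →
      MeasurePreserving (fun (x : Fin d → ℝ) i => if i ∈ A then structuralResidual F i x else x i)
        volume volume := by
    intro A
    induction A using Finset.strongInduction with
    | _ A ih =>
      intro hA
      rcases A.eq_empty_or_nonempty with rfl | hne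
      · simpa using! MeasurePreserving.id volume
      -- All parents of this source `a` of `A` lie outside `A`, so they still hold their original
      -- values when coordinate `a` is updated last.
      obtain ⟨a, haA, ha⟩ := hG.wellFounded.has_min (A : Set (Fin d)) hne
      have hstep := ih (A.erase a) (Finset.erase_ssubset haA) fun j hj i hji =>
        Finset.mem_erase.2 ⟨fun hia => ha j (Finset.mem_of_mem_erase hj) (hia ▸ hji),
          hA j (Finset.mem_of_mem_erase hj) i hji⟩
      have hdep_a : DependsOn (F a) {a}ᶜ := (hdep a).mono fun j hj hja => by
        rw [Set.mem_singleton_iff] at hja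
        exact hG a (.single (hja ▸ hj))
      convert (measurePreserving_update_sub a (hF a).measurable hdep_a).comp hstep using 1
      ext x i
      have hFa : F a (fun i => if i ∈ A.erase a then structuralResidual F i x else x i) = F a x :=
        hdep a fun j hj => by
          have : j ∉ A := fun hjA => ha j hjA hj
          simp [this]
      simp only [Function.comp_apply, hFa]
      by_cases hia : i = a
      · subst hia
        simp [Finset.mem_coe.1 haA, structuralResidual]
      · simp [hia]
  simpa using key Finset.univ (by simp)

/-- If the residuals are independent with laws that dominate the Lebesgue measure, then the joint
law dominates the Lebesgue measure. -/
theorem volume_absolutelyContinuous (hG : IsDAG G) {F : Fin d → (Fin d → ℝ) → ℝ}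
    (hF : ∀ i, Continuous (F i)) (hdep : ∀ i, DependsOn (F i) (parents G i))
    (P : Measure (Fin d → ℝ)) [IsProbabilityMeasure P] (hind : iIndepFun (structuralResidual F) P)
    (hac : ∀ i, volume ≪ P.map (structuralResidual F i)) : volume ≪ P := by
  have hmeas : Measurable fun (x : Fin d → ℝ) i => structuralResidual F i x :=
    measurable_pi_lambda _ (measurable_residual hF)
  have hprob : ∀ i, IsProbabilityMeasure (P.map (structuralResidual F i)) := fun i =>
    Measure.isProbabilityMeasure_map (measurable_residual hF i).aemeasurable
  have hpi : P.map (fun x i => structuralResidual F i x) =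
      Measure.pi fun i => P.map (structuralResidual F i) :=
    (iIndepFun_iff_map_fun_eq_pi_map fun i => (measurable_residual hF i).aemeasurable).1 hind
  have hvol := volume_absolutelyContinuous_pi _ hac
  rw [← hpi] at hvol
  refine Measure.AbsolutelyContinuous.mk fun A hA hPA => ?_
  have hinj := residual_injective hG hdep
  have hemb := hmeas.measurableEmbedding hinj
  -- A null set of `P` is transported to its image under the residual map, where the law is a
  -- product; injectivity makes the image measurable.
  have himg := hemb.measurableSet_image.2 hA
  have h₁ := (measurePreserving_residual hG hF hdep).measure_preimage himg.nullMeasurableSet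
  rw [Set.preimage_image_eq _ hinj] at h₁
  rw [h₁]
  apply hvol
  rw [Measure.map_apply hmeas himg, Set.preimage_image_eq _ hinj, hPA]

theorem self_notMem_nonDescendants (G : Digraph (Fin d)) (i : Fin d) : i ∉ nonDescendants G i :=
  fun h => h .refl

theorem parents_subset_nonDescendants {G H : Digraph (Fin d)} (hH : IsDAG H) (hGH : G ≤ H)
    (i : Fin d) : parents H i ⊆ nonDescendants G i := by
  intro j hj hij
  have h : Relation.ReflTransGen H.Adj i j :=
    Relation.ReflTransGen.mono (fun _ _ hab => hGH hab) _ _ hij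
  exact hH i (Relation.TransGen.tail' h hj)

theorem measurable_coordinate {Ω : Type*} {_ : MeasurableSpace Ω} {F : Fin d → (Fin d → ℝ) → ℝ}
    (hF : ∀ i, Continuous (F i)) (hdep : ∀ i, DependsOn (F i) (parents G i))
    (X : Ω → Fin d → ℝ) (j : Fin d) (hres : Measurable fun ω => structuralResidual F j (X ω))
    (hpar : ∀ k ∈ parents G j, Measurable fun ω => X ω k) : Measurable fun ω => X ω j := by
  classical
  have hproj : Measurable fun ω k => if k ∈ parents G j then X ω k else 0 := by
    refine measurable_pi_lambda _ fun k => ?_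
    by_cases hk : k ∈ parents G j
    · simpa [hk] using hpar k hk
    · simp [hk]
  have hFj : Measurable fun ω => F j (X ω) := by
    convert (hF j).measurable.comp hproj using 1
    ext ω
    exact hdep j fun k hk => by simp [hk]
  convert hres.add hFj using 1
  ext ω
  simp [structuralResidual]

/-- In a structural equation model with independent residuals, each residual is independent of the
non-descendants. -/
theorem indepFun_residual_nonDescendants (hG : IsDAG G) {F : Fin d → (Fin d → ℝ) → ℝ}
    (hF : ∀ i, Continuous (F i)) (hdep : ∀ i, DependsOn (F i) (parents G i))
    (P : Measure (Fin d → ℝ)) (hind : iIndepFun (structuralResidual F) P)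
    (i : Fin d) {S : Set (Fin d)} (hS : S ⊆ nonDescendants G i) :
    IndepFun (structuralResidual F i) (fun (x : Fin d → ℝ) (k : S) => x k) P := by
  let m : Fin d → MeasurableSpace (Fin d → ℝ) := fun j =>
    MeasurableSpace.comap (structuralResidual F j) inferInstance
  -- Parents of a non-descendant are non-descendants, so the induction never uses the residual at
  -- `i`.
  have hcoord : ∀ j, j ∈ nonDescendants G i →
      Measurable[⨆ k ∈ nonDescendants G i, m k] fun x : Fin d → ℝ => x j := by
    intro j
    induction j using hG.wellFounded.induction with
    | _ j ih =>
      intro hj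
      exact measurable_coordinate hF hdep id j
        ((comap_measurable (structuralResidual F j)).mono (le_iSup₂_of_le j hj le_rfl) le_rfl)
        fun k hk => ih k hk fun hik => hj (hik.tail hk)
  have hle : ∀ j, m j ≤ MeasurableSpace.pi := fun j => (measurable_residual hF j).comap_le
  have hindep := indep_iSup_of_disjoint hle hind
    (Set.disjoint_singleton_left.2 (self_notMem_nonDescendants G i))
  refine (IndepFun_iff_Indep _ _ _).2 (indep_of_indep_of_le_left
    (indep_of_indep_of_le_right hindep ?_) ?_)
  · exact ((@measurable_pi_iff _ _ _ (_) _ _).2 fun k : S => hcoord k (hS k.2)).comap_le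
  · exact le_iSup₂_of_le i rfl le_rfl

end CausalDAG

/-! ### Conditional laws under additive independent noise -/

namespace CausalDAG

section Noise

variable {Ω β γ : Type*} [MeasurableSpace Ω] [MeasurableSpace β] [MeasurableSpace γ]

/-- The law of `F z + e` as a function of `z`, where `e` has law `N`. -/
noncomputable def noiseKernel (N : Measure ℝ) (F : β → ℝ) : Kernel β ℝ :=
  (Kernel.id ×ₖ Kernel.const β N).map fun p => F p.1 + p.2

instance (N : Measure ℝ) [IsFiniteMeasure N] (F : β → ℝ) : IsFiniteKernel (noiseKernel N F) := by
  unfold noiseKernel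
  infer_instance

theorem noiseKernel_apply (N : Measure ℝ) [SFinite N] {F : β → ℝ} (hF : Measurable F) (z : β)
    {s : Set ℝ} (hs : MeasurableSet s) : noiseKernel N F z s = N {t | F z + t ∈ s} := by
  have hm : Measurable fun p : β × ℝ => F p.1 + p.2 := by fun_prop
  rw [noiseKernel, Kernel.map_apply' _ hm _ hs, Kernel.prod_apply, Kernel.id_apply,
    Kernel.const_apply, Measure.prod_apply (hm hs), lintegral_dirac']
  · rfl
  · exact measurable_measure_prodMk_left (hm hs)

theorem condDistrib_add_of_indepFun (μ : Measure Ω) [IsFiniteMeasure μ] {Z : Ω → β} {e : Ω → ℝ}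
    (hZ : Measurable Z) (he : Measurable e) (hind : IndepFun e Z μ) {F : β → ℝ}
    (hF : Measurable F) :
    condDistrib (fun ω => F (Z ω) + e ω) Z μ =ᵐ[μ.map Z] noiseKernel (μ.map e) F := by
  refine condDistrib_ae_eq_of_measure_eq_compProd Z (by fun_prop) ?_
  have hm : Measurable fun p : β × ℝ => (p.1, F p.1 + p.2) := by fun_prop
  have hprod := (indepFun_iff_map_prod_eq_prod_map_map hZ.aemeasurable he.aemeasurable).1 hind.symm
  have hmap : μ.map (fun ω => (Z ω, F (Z ω) + e ω)) =
      ((μ.map Z).prod (μ.map e)).map fun p => (p.1, F p.1 + p.2) := by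
    rw [← hprod, Measure.map_map hm (by fun_prop)]
    rfl
  rw [hmap]
  ext s hs
  rw [Measure.map_apply hm hs, Measure.prod_apply (hm hs), Measure.compProd_apply hs]
  refine lintegral_congr fun z => ?_
  rw [noiseKernel_apply _ hF _ (measurable_prodMk_left hs)]
  rfl

variable [StandardBorelSpace Ω] [StandardBorelSpace γ] [Nonempty γ]

/-- If `e` is independent of `(U, V)`, then `F V + e` is independent of `U` given `V`. -/
theorem condIndepFun_add_of_indepFun (μ : Measure Ω) [IsFiniteMeasure μ] {U : Ω → γ} {V : Ω → β}
    {e : Ω → ℝ} (hU : Measurable U) (hV : Measurable V) (he : Measurable e)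
    (hind : IndepFun e (fun ω => (V ω, U ω)) μ) {F : β → ℝ} (hF : Measurable F) :
    CondIndepFun (MeasurableSpace.comap V inferInstance) hV.comap_le
      (fun ω => F (V ω) + e ω) U μ := by
  refine CondIndepFun.symm ?_
  rw [condIndepFun_iff_condDistrib_prod_ae_eq_prodMkRight (by fun_prop) hU hV]
  have h₁ := condDistrib_add_of_indepFun μ (hV.prodMk hU) he hind
    (F := fun p : β × γ => F p.1) (by fun_prop)
  have h₂ := condDistrib_add_of_indepFun μ hV he (hind.comp measurable_id measurable_fst) hF
  have hq : Measure.QuasiMeasurePreserving Prod.fst (μ.map fun ω => (V ω, U ω)) (μ.map V) := by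
    refine ⟨measurable_fst, ?_⟩
    rw [Measure.map_map measurable_fst (by fun_prop)]
    exact Measure.AbsolutelyContinuous.rfl
  filter_upwards [h₁, hq.ae h₂] with p hp₁ hp₂
  rw [hp₁, Kernel.prodMkRight_apply, hp₂]
  ext s hs
  rw [noiseKernel_apply _ (by fun_prop) _ hs, noiseKernel_apply _ hF _ hs]

/-- If `F (V, U) + e` is independent of `U` given `V`, where `e` is independent of `(V, U)`, then
the probability that the noise is at most `-F (V, U)` is a function of `V`. -/
theorem exists_measure_Iic_eq_of_condIndepFun (μ : Measure Ω) [IsFiniteMeasure μ] {U : Ω → γ}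
    {V : Ω → β} {Y e : Ω → ℝ} (hU : Measurable U) (hV : Measurable V) (he : Measurable e)
    (hind : IndepFun e (fun ω => (V ω, U ω)) μ) {F : β × γ → ℝ} (hF : Measurable F)
    (hY : Y = fun ω => F (V ω, U ω) + e ω)
    (hci : CondIndepFun (MeasurableSpace.comap V inferInstance) hV.comap_le Y U μ) :
    ∃ h : β → ENNReal, ∀ᵐ ω ∂μ, μ.map e (Set.Iic (-F (V ω, U ω))) = h (V ω) := by
  have hYm : Measurable Y := by
    rw [hY]
    fun_prop
  have h₂ := (condIndepFun_iff_condDistrib_prod_ae_eq_prodMkRight hYm hU hV).1 hci.symm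
  have h₁ := condDistrib_add_of_indepFun μ (hV.prodMk hU) he hind hF
  -- Evaluating the conditional law at the half-line up to `0` suffices: `F + e ≤ 0` means `e ≤ -F`.
  refine ⟨fun v => condDistrib Y V μ v (Set.Iic 0), ?_⟩
  have hq : Measure.QuasiMeasurePreserving (fun ω => (V ω, U ω)) μ (μ.map fun ω => (V ω, U ω)) :=
    ⟨by fun_prop, Measure.AbsolutelyContinuous.rfl⟩
  filter_upwards [hq.ae h₁, hq.ae h₂] with ω hω₁ hω₂
  rw [← hY, hω₂, Kernel.prodMkRight_apply] at hω₁
  simp only at hω₁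
  rw [hω₁, noiseKernel_apply _ hF _ measurableSet_Iic]
  congr 1
  ext t
  simp [le_neg_iff_add_nonpos_left]

end Noise

end CausalDAG

/-! ### Screening sets and the structural functions -/

namespace CausalDAG

variable {d : ℕ}

theorem condIndepCoord_singleton_iff (P : Measure (Fin d → ℝ)) [IsFiniteMeasure P] (i : Fin d)
    (B C : Set (Fin d)) :
    CondIndepCoord P {i} B C ↔
      CondIndepFun (MeasurableSpace.comap (fun (x : Fin d → ℝ) (k : C) => x k) inferInstance)
        (Measurable.comap_le (measurable_pi_lambda _ fun k => measurable_pi_apply (k : Fin d)))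
        (fun x : Fin d → ℝ => x i) (fun (x : Fin d → ℝ) (k : B) => x k) P := by
  constructor
  · intro h
    exact h.comp (measurable_pi_apply (⟨i, rfl⟩ : ({i} : Set (Fin d)))) measurable_id
  · intro h
    have := h.comp (φ := fun (r : ℝ) (_ : ({i} : Set (Fin d))) => r)
      (measurable_pi_lambda _ fun _ => measurable_id) measurable_id
    have heq : (fun (x : Fin d → ℝ) (k : ({i} : Set (Fin d))) => x k) =
        (fun (r : ℝ) (_ : ({i} : Set (Fin d))) => r) ∘ fun x => x i := by
      ext x ⟨k, rfl⟩
      rfl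
    rw [CondIndepCoord, heq]
    exact this

/-- A function of the coordinates in `S`, as a function on `S → ℝ`. -/
noncomputable def restrictFun {S : Set (Fin d)} (F : (Fin d → ℝ) → ℝ) (v : S → ℝ) : ℝ :=
  open Classical in F fun k => if hk : k ∈ S then v ⟨k, hk⟩ else 0

theorem measurable_restrictFun {S : Set (Fin d)} {F : (Fin d → ℝ) → ℝ} (hF : Continuous F) :
    Measurable (restrictFun F : (S → ℝ) → ℝ) := by
  classical
  refine hF.measurable.comp (measurable_pi_lambda _ fun k => ?_)
  by_cases hk : k ∈ S
  · simpa [hk] using measurable_pi_apply _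
  · simp [hk]

theorem restrictFun_apply {S : Set (Fin d)} {F : (Fin d → ℝ) → ℝ} (hF : DependsOn F S)
    (x : Fin d → ℝ) : restrictFun F (fun k : S => x k) = F x :=
  hF fun k hk => by simp [hk]

theorem add_structuralResidual (F : Fin d → (Fin d → ℝ) → ℝ) (i : Fin d) (x : Fin d → ℝ) :
    F i x + structuralResidual F i x = x i := by
  simp [structuralResidual]

variable {G : Digraph (Fin d)} {F : Fin d → (Fin d → ℝ) → ℝ}

theorem condIndepCoord_parents (hG : IsDAG G) (hF : ∀ i, Continuous (F i))
    (hdep : ∀ i, DependsOn (F i) (parents G i)) (P : Measure (Fin d → ℝ)) [IsFiniteMeasure P]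
    (hind : iIndepFun (structuralResidual F) P) (i : Fin d) {B : Set (Fin d)}
    (hB : B ⊆ nonDescendants G i) : CondIndepCoord P {i} B (parents G i) := by
  rw [condIndepCoord_singleton_iff]
  have hpa : parents G i ⊆ nonDescendants G i := parents_subset_nonDescendants hG le_rfl i
  have hres := indepFun_residual_nonDescendants hG hF hdep P hind i (S := nonDescendants G i)
    le_rfl
  have hpair := hres.comp measurable_id
    (ψ := fun v => ((fun k : parents G i => v ⟨k, hpa k.2⟩), fun k : B => v ⟨k, hB k.2⟩))
    (by fun_prop)
  have := condIndepFun_add_of_indepFun P (U := fun (x : Fin d → ℝ) (k : B) => x k)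
    (V := fun (x : Fin d → ℝ) (k : parents G i) => x k) (by fun_prop) (by fun_prop)
    (measurable_residual hF i) hpair (measurable_restrictFun (hF i))
  simpa only [restrictFun_apply (hdep i), add_structuralResidual] using this

theorem isMarkov_of_residual (hG : IsDAG G) (hF : ∀ i, Continuous (F i))
    (hdep : ∀ i, DependsOn (F i) (parents G i)) (P : Measure (Fin d → ℝ)) [IsFiniteMeasure P]
    (hind : iIndepFun (structuralResidual F) P) : IsMarkov P G :=
  fun i => condIndepCoord_parents hG hF hdep P hind i Set.sdiff_subset

theorem dependsOn_of_condIndepCoord (hG : IsDAG G) (hF : ∀ i, Continuous (F i))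
    (hdep : ∀ i, DependsOn (F i) (parents G i)) (P : Measure (Fin d → ℝ)) [IsProbabilityMeasure P]
    (hind : iIndepFun (structuralResidual F) P)
    (hac : ∀ i, volume ≪ P.map (structuralResidual F i)) (i : Fin d)
    {S T : Set (Fin d)} (hS : S ⊆ nonDescendants G i) (hpa : parents G i ⊆ S) (hT : T ⊆ S)
    (hci : CondIndepCoord P {i} (S \ T) T) : DependsOn (F i) T := by
  classical
  rw [condIndepCoord_singleton_iff] at hci
  -- The value `0` off `S` is harmless, since `F i` only reads parents, which lie in `S`.
  let glue : (T → ℝ) × (↥(S \ T) → ℝ) → Fin d → ℝ := fun p k =>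
    if hk : k ∈ T then p.1 ⟨k, hk⟩ else if hk' : k ∈ S \ T then p.2 ⟨k, hk'⟩ else 0
  have hglue : Measurable glue := by
    refine measurable_pi_lambda _ fun k => ?_
    by_cases hk : k ∈ T
    · simp only [glue, hk, dif_pos]
      fun_prop
    · by_cases hk' : k ∈ S \ T
      · simp only [glue, hk, hk', dif_pos, dif_neg, not_false_iff]
        fun_prop
      · simp only [glue, hk, hk', dif_neg, not_false_iff]
        fun_prop
  have hFglue : ∀ x : Fin d → ℝ, F i (glue (fun k => x k, fun k => x k)) = F i x := fun x =>
    hdep i fun k hk => by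
      by_cases hkT : k ∈ T
      · simp [glue, hkT]
      · simp [glue, hkT, hpa hk]
  have hres := indepFun_residual_nonDescendants hG hF hdep P hind i hS
  have hpair := hres.comp measurable_id
    (ψ := fun v => ((fun k : T => v ⟨k, hT k.2⟩), fun k : ↥(S \ T) => v ⟨k, k.2.1⟩))
    (by fun_prop)
  obtain ⟨h, hh⟩ := exists_measure_Iic_eq_of_condIndepFun P
    (U := fun (x : Fin d → ℝ) (k : ↥(S \ T)) => x k)
    (V := fun (x : Fin d → ℝ) (k : T) => x k) (by fun_prop) (by fun_prop)
    (measurable_residual hF i) hpair (F := fun p => F i (glue p)) ((hF i).measurable.comp hglue)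
    (by ext x; simp only [hFglue, add_structuralResidual]) hci
  simp only [hFglue] at hh
  exact dependsOn_of_ae (hF i) T _ (measure_Iic_neg_injective _ (hac i)) h
    ((volume_absolutelyContinuous hG hF hdep P hind hac).ae_le hh)

/-- The same functions and residuals form a structural model on the graph without the edges into `i`
from outside `T`, so `P` is Markov for it; minimality rules out any such deletion. -/
theorem parents_subset_of_dependsOn (hG : IsDAG G) (hF : ∀ i, Continuous (F i))
    (hdep : ∀ i, DependsOn (F i) (parents G i)) (P : Measure (Fin d → ℝ)) [IsFiniteMeasure P]
    (hind : iIndepFun (structuralResidual F) P) (hmin : CausallyMinimal P G) (i : Fin d)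
    {T : Set (Fin d)} (hT : DependsOn (F i) T) : parents G i ⊆ T := by
  intro j hj
  by_contra hjT
  let G' : Digraph (Fin d) := ⟨fun a b => G.Adj a b ∧ (b = i → a ∈ T)⟩
  have hle : G' ≤ G := fun a b hab => hab.1
  have hlt : G' < G := lt_of_le_not_ge hle fun h => hjT ((h hj).2 rfl)
  refine hmin G' hlt (isMarkov_of_residual (hG.mono hle) hF (fun k => ?_) P hind)
  by_cases hk : k = i
  · subst hk
    exact ((hdep k).inter hT).mono fun a ha => ⟨ha.1, fun _ => ha.2⟩
  · exact (hdep k).mono fun a ha => ⟨ha, fun h => absurd h hk⟩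

end CausalDAG

/-! ### The main theorem -/

theorem mainTheorem2 {d : ℕ} (G H : Digraph (Fin d))
    (hG : CausalDAG.IsDAG G) (hH : CausalDAG.IsDAG H) (hGH : G ≤ H)
    (M : CausalDAG.AdditiveNoiseModel G)
    {Ω : Type*} [MeasurableSpace Ω] (μ : Measure Ω) [IsProbabilityMeasure μ]
    (X ε : Fin d → Ω → ℝ) (hX : M.IsSolution μ X ε)
    (hmin : CausalDAG.CausallyMinimal (CausalDAG.jointLaw μ X) G) (i : Fin d) :
    CausalDAG.IsMinimalScreen (CausalDAG.jointLaw μ X) H i (CausalDAG.parents G i) ∧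
      ∀ T : Set (Fin d), CausalDAG.IsMinimalScreen (CausalDAG.jointLaw μ X) H i T →
        T = CausalDAG.parents G i := by
  open CausalDAG in
  have hXm : Measurable fun ω i => X i ω := measurable_pi_lambda _ hX.measurable_var
  have hP : IsProbabilityMeasure (jointLaw μ X) :=
    Measure.isProbabilityMeasure_map hXm.aemeasurable
  let F : Fin d → (Fin d → ℝ) → ℝ := fun i x => M.f i fun j => x j
  have hF : ∀ i, Continuous (F i) := fun i => (M.continuous_f i).comp (by fun_prop)
  have hdep : ∀ i, DependsOn (F i) (parents G i) := fun i x y hxy =>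
    congrArg (M.f i) (funext fun j => hxy j j.2)
  -- Almost surely the noise is the residual of `X`, so the argument can take place on `ℝ^d` under
  -- the joint law.
  have hres : ∀ i, (fun ω => structuralResidual F i fun j => X j ω) =ᵐ[μ] ε i := fun i => by
    filter_upwards [hX.structural_eq i] with ω hω
    simp [structuralResidual, F, hω]
  have hlaw : ∀ i, (jointLaw μ X).map (structuralResidual F i) = μ.map (ε i) := fun i => by
    rw [Measure.map_map (measurable_residual hF i) hXm]
    exact Measure.map_congr (hres i)
  have hind : iIndepFun (structuralResidual F) (jointLaw μ X) := by
    rw [iIndepFun_iff_map_fun_eq_pi_map fun i => (measurable_residual hF i).aemeasurable]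
    simp only [hlaw]
    rw [← (iIndepFun_iff_map_fun_eq_pi_map fun i => (hX.measurable_noise i).aemeasurable).1
      hX.indep_noise, Measure.map_map (measurable_pi_lambda _ (measurable_residual hF)) hXm]
    refine Measure.map_congr ?_
    filter_upwards [ae_all_iff.2 hres] with ω hω
    exact funext hω
  have hac : ∀ i, volume ≪ (jointLaw μ X).map (structuralResidual F i) := fun i => by
    rw [hlaw, hX.map_noise]
    exact withDensity_absolutelyContinuous'
      (M.measurable_noiseDensity i).ennreal_ofReal.aemeasurable
      (ae_of_all _ fun t => (ENNReal.ofReal_pos.2 (M.noiseDensity_pos i t)).ne')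
  have hpaH : parents G i ⊆ parents H i := fun j hj => hGH hj
  have hnd : parents H i ⊆ nonDescendants G i := parents_subset_nonDescendants hH hGH i
  have hscreen : ScreensOff (jointLaw μ X) H i (parents G i) :=
    condIndepCoord_parents hG hF hdep _ hind i (Set.sdiff_subset.trans hnd)
  have hsub : ∀ T ⊆ parents H i, ScreensOff (jointLaw μ X) H i T → parents G i ⊆ T :=
    fun T hT hs => parents_subset_of_dependsOn hG hF hdep _ hind hmin i
      (dependsOn_of_condIndepCoord hG hF hdep _ hind hac i hnd hpaH hT hs)
  refine ⟨⟨hpaH, hscreen, fun T' hT' hs => ?_⟩, fun T hT => ?_⟩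
  · exact hT'.not_subset (hsub T' (hT'.subset.trans hpaH) hs)
  · by_contra hne
    exact hT.minimal _ ((hsub T hT.subset_parents hT.screensOff).ssubset_of_ne (Ne.symm hne))
      hscreen
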